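/- Let $(M,g)$ be a smooth Riemannian manifold and let $\pi$ be a Poisson tensor on $M$, i.e. a smooth bivector field such that $\{f,h\}=\pi(df,dh)$ satisfies the Jacobi identity on $C^\infty(M)$. Let $\pi_\#:T^*M\to TM$ be the anchor map, $\beta(\pi_\#(\alpha))=\pi(\alpha,\beta)$, and let $[\alpha,\beta]_\pi=L_{\pi_\#(\alpha)}\beta-L_{\pi_\#(\beta)}\alpha-d(\pi(\alpha,\beta))$ be the Koszul bracket of 1-forms. Assume that $\pi$ is regular, i.e. that the rank of $\pi$ is constant on $M$; the symplectic foliation $\mathcal F$ is the foliation tangent to $\operatorname{Im}\pi_\#$. Write $\langle\cdot,\cdot\rangle$ for the metric induced by $g$ on covectors. The metric contravariant connection associated to $(\pi,g)$ is the unique map $\mathcal D:\Omega^1(M)\times\Omega^1(M)\to\Omega^1(M)$ that is $C^\infty(M)$-linear in the first argument, $\mathbb R$-linear in the second, and satisfies $$\mathcal D_\alpha(f\beta)=f\mathcal D_\alpha\beta+\pi_\#(\alpha)(f)\,\beta,\qquad \mathcal D_\alpha\beta-\mathcal D_\beta\alpha=[\alpha,\beta]_\pi,\qquad \pi_\#(\alpha)\cdot\langle\beta,\gamma\rangle=\langle\mathcal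 D_\alpha\beta,\gamma\rangle+\langle\beta,\mathcal D_\alpha\gamma\rangle .$$ Assume that $\mathcal D$ is an $\mathcal F$-connection, i.e. that $\pi_\#(\alpha)=0$ implies $\mathcal D_\alpha=0$. For an open set $U\subset M$, a smooth vector field $X$ on $U$ is called perpendicular to $\mathcal F$ if $g(X,v)=0$ for every vector $v$ tangent to $\mathcal F$ at a point of $U$; foliated if $[X,Y]$ is tangent to $\mathcal F$ for every smooth vector field $Y$ on $U$ tangent to $\mathcal F$; and a Poisson vector field if $L_X\pi=0$ on $U$. Then: 1. The metric $g$ is bundle-like for $\mathcal F$: for every open set $U\subset M$ and all smooth foliated vector fields $X,Y$ on $U$ perpendicular to $\mathcal F$, the function $g(X,Y)$ is a Casimir function on $U$, i.e. $\pi_\#(d(g(X,Y)))=0$ on $U$. 2. For every open set $U\subset M$ and every smooth vector field $X$ on $U$ perpendicular to $\mathcal F$, $X$ is a foliated vector field if and only if $X$ is a Poisson vector field. -/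

import Mathlib

open scoped Manifold ContDiff Topology

set_option maxSynthPendingDepth 3
set_option linter.unusedSectionVars false

noncomputable section

namespace RiemannPoisson

/-! ### Vector fields, one-forms and bivector fields

`M` is a smooth manifold without boundary modelled on the finite-dimensional real vector space `E`.
Fields are total functions on `M`; a field "on an open set `U`" is a field of which only the values
on `U` are used. -/

/-- The cotangent space of `M` at `x`. -/
abbrev CotangentSpace (E : Type*) [NormedAddCommGroup E] [NormedSpace ℝ E]
    {M : Type*} [TopologicalSpace M] [ChartedSpace E M] (x : M) : Type _ :=
  TangentSpace 𝓘(ℝ, E) x →L[ℝ] ℝ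

/-- Vector fields on `M`, without regularity. -/
abbrev VecField (E : Type*) [NormedAddCommGroup E] [NormedSpace ℝ E]
    (M : Type*) [TopologicalSpace M] [ChartedSpace E M] : Type _ :=
  (x : M) → TangentSpace 𝓘(ℝ, E) x

/-- One-forms on `M`, without regularity. -/
abbrev OneForm (E : Type*) [NormedAddCommGroup E] [NormedSpace ℝ E]
    (M : Type*) [TopologicalSpace M] [ChartedSpace E M] : Type _ :=
  (x : M) → CotangentSpace E x

/-- `f ∈ C^∞(U)`. -/
def SmoothFunctionOn (E : Type*) [NormedAddCommGroup E] [NormedSpace ℝ E]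
    {M : Type*} [TopologicalSpace M] [ChartedSpace E M] (f : M → ℝ) (U : Set M) : Prop :=
  ContMDiffOn 𝓘(ℝ, E) 𝓘(ℝ, ℝ) ∞ f U

/-- The differential `df` of a function. -/
def differential (E : Type*) [NormedAddCommGroup E] [NormedSpace ℝ E]
    {M : Type*} [TopologicalSpace M] [ChartedSpace E M] (f : M → ℝ) : OneForm E M :=
  fun x ↦ mvfderiv 𝓘(ℝ, E) f x

variable {E : Type*} [NormedAddCommGroup E] [NormedSpace ℝ E] [FiniteDimensional ℝ E]
  {M : Type*} [TopologicalSpace M] [ChartedSpace E M] [IsManifold 𝓘(ℝ, E) ∞ M]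

/-- The vector field `X` is smooth on `U`. -/
def SmoothVectorFieldOn (X : VecField E M) (U : Set M) : Prop :=
  ContMDiffOn 𝓘(ℝ, E) (𝓘(ℝ, E).prod 𝓘(ℝ, E)) ∞
    (fun x ↦ Bundle.TotalSpace.mk' E (E := fun x : M ↦ TangentSpace 𝓘(ℝ, E) x) x (X x)) U

/-- The one-form `α` is smooth on `U`, as a section of the cotangent bundle. -/
def SmoothOneFormOn (α : OneForm E M) (U : Set M) : Prop :=
  ContMDiffOn 𝓘(ℝ, E) (𝓘(ℝ, E).prod 𝓘(ℝ, E →L[ℝ] ℝ)) ∞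
    (fun x ↦ Bundle.TotalSpace.mk' (E →L[ℝ] ℝ) (E := fun x : M ↦ CotangentSpace E x) x (α x)) U

variable (E M) in
/-- A smooth bivector field, that is, a smooth field of alternating bilinear forms on the cotangent
spaces. -/
structure BivectorField where
  /-- the value at a point -/
  form (x : M) : CotangentSpace E x →L[ℝ] CotangentSpace E x →L[ℝ] ℝ
  alternating (x : M) (α : CotangentSpace E x) : form x α α = 0
  smooth : ContMDiff 𝓘(ℝ, E) (𝓘(ℝ, E).prod 𝓘(ℝ, (E →L[ℝ] ℝ) →L[ℝ] (E →L[ℝ] ℝ) →L[ℝ] ℝ)) ∞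
    (fun x : M ↦ Bundle.TotalSpace.mk' ((E →L[ℝ] ℝ) →L[ℝ] (E →L[ℝ] ℝ) →L[ℝ] ℝ)
      (E := fun x : M ↦ CotangentSpace E x →L[ℝ] CotangentSpace E x →L[ℝ] ℝ) x (form x))

/-- The bracket `{f, g} = P(df, dg)` of a bivector field. -/
def BivectorField.bracket (P : BivectorField E M) (f g : M → ℝ) : M → ℝ :=
  fun x ↦ P.form x (differential E f x) (differential E g x)

/-- A bivector field is a Poisson tensor if its bracket satisfies the Jacobi identity on `C^∞(M)`
(being bilinear, alternating and a derivation in each argument, it is then a Poisson bracket). -/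
def BivectorField.IsPoisson (P : BivectorField E M) : Prop :=
  ∀ f g h : M → ℝ, SmoothFunctionOn E f Set.univ → SmoothFunctionOn E g Set.univ →
    SmoothFunctionOn E h Set.univ → ∀ x : M,
      P.bracket f (P.bracket g h) x + P.bracket g (P.bracket h f) x
        + P.bracket h (P.bracket f g) x = 0

/-! ### The anchor map, rank, Hamiltonian vector fields and Casimir functions -/

/-- The linear map `V* → V` attached to a bilinear form `b` on the dual `V*` of a finite-dimensional
space `V`, through the isomorphism of `V` with its bidual: `β(b_#(α)) = b(α, β)`. -/
def sharpMap {V : Type*} [NormedAddCommGroup V] [NormedSpace ℝ V] [FiniteDimensional ℝ V]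
    (b : (V →L[ℝ] ℝ) →L[ℝ] (V →L[ℝ] ℝ) →L[ℝ] ℝ) : (V →L[ℝ] ℝ) →ₗ[ℝ] V where
  toFun α := (Module.evalEquiv ℝ V).symm
    ((b α).toLinearMap ∘ₗ (LinearMap.toContinuousLinearMap : (V →ₗ[ℝ] ℝ) ≃ₗ[ℝ] (V →L[ℝ] ℝ)))
  map_add' α β := by
    rw [← map_add]
    congr 1
    ext γ
    simp
  map_smul' c α := by
    rw [← map_smul]
    congr 1
    ext γ
    simp

theorem apply_sharpMap {V : Type*} [NormedAddCommGroup V] [NormedSpace ℝ V] [FiniteDimensional ℝ V]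
    (b : (V →L[ℝ] ℝ) →L[ℝ] (V →L[ℝ] ℝ) →L[ℝ] ℝ) (α β : V →L[ℝ] ℝ) : β (sharpMap b α) = b α β :=
  Module.apply_evalEquiv_symm_apply ℝ V (β : V →ₗ[ℝ] ℝ)
    ((b α).toLinearMap ∘ₗ (LinearMap.toContinuousLinearMap : (V →ₗ[ℝ] ℝ) ≃ₗ[ℝ] (V →L[ℝ] ℝ)))

/-- The anchor map `P_# : T*M → TM`, characterised by `β(P_#(α)) = P(α, β)`. -/
def BivectorField.anchor (P : BivectorField E M) (x : M) :
    CotangentSpace E x →ₗ[ℝ] TangentSpace 𝓘(ℝ, E) x :=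
  sharpMap (V := E) (P.form x)

theorem BivectorField.apply_anchor (P : BivectorField E M) (x : M) (α β : CotangentSpace E x) :
    β (P.anchor x α) = P.form x α β :=
  apply_sharpMap (V := E) (P.form x) α β

/-- The rank of a bivector field at a point, i.e. the rank of its anchor map. -/
def BivectorField.rank (P : BivectorField E M) (x : M) : ℕ :=
  Module.finrank ℝ (LinearMap.range (P.anchor x))

/-- A bivector field is regular if its rank is constant on `M`. -/
def BivectorField.IsRegular (P : BivectorField E M) : Prop :=
  ∀ x y : M, P.rank x = P.rank y

/-- The Hamiltonian vector field `H_f = {f, ·} = P_#(df)`. -/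
def BivectorField.hamiltonian (P : BivectorField E M) (f : M → ℝ) : VecField E M :=
  fun x ↦ P.anchor x (differential E f x)

/-- `f` is a Casimir function on `U`: a smooth function whose Hamiltonian vector field vanishes. -/
def BivectorField.IsCasimirOn (P : BivectorField E M) (f : M → ℝ) (U : Set M) : Prop :=
  SmoothFunctionOn E f U ∧ ∀ x ∈ U, P.hamiltonian f x = 0

/-! ### Lie derivatives and the Koszul bracket -/

/-- The vector field `X` is differentiable at `x`. -/
def DifferentiableVecFieldAt (X : VecField E M) (x : M) : Prop :=
  MDifferentiableAt 𝓘(ℝ, E) (𝓘(ℝ, E).prod 𝓘(ℝ, E))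
    (fun x ↦ Bundle.TotalSpace.mk' E (E := fun x : M ↦ TangentSpace 𝓘(ℝ, E) x) x (X x)) x

/-- The one-form `α` is differentiable at `x`. -/
def DifferentiableOneFormAt (α : OneForm E M) (x : M) : Prop :=
  MDifferentiableAt 𝓘(ℝ, E) (𝓘(ℝ, E).prod 𝓘(ℝ, E →L[ℝ] ℝ))
    (fun x ↦ Bundle.TotalSpace.mk' (E →L[ℝ] ℝ) (E := fun x : M ↦ CotangentSpace E x) x (α x)) x

/-- The function `X(α(Y)) - α([X, Y])`. -/
def lieDerivOneFormAux (X : VecField E M) (α : OneForm E M) (Y : VecField E M) (x : M) : ℝ :=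
  differential E (fun y ↦ α y (Y y)) x (X x) - α x (VectorField.mlieBracket 𝓘(ℝ, E) X Y x)

theorem mdifferentiableAt_apply {α : OneForm E M} {Y : VecField E M} {x : M}
    (hα : DifferentiableOneFormAt α x) (hY : DifferentiableVecFieldAt Y x) :
    MDifferentiableAt 𝓘(ℝ, E) 𝓘(ℝ, ℝ) (fun y ↦ α y (Y y)) x := by
  have h : MDifferentiableAt 𝓘(ℝ, E) (𝓘(ℝ, E).prod 𝓘(ℝ, ℝ)) (fun m : M ↦
      Bundle.TotalSpace.mk' ℝ (E := Bundle.Trivial M ℝ) m (α m (Y m))) x :=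
    MDifferentiableAt.clm_bundle_apply (E₂ := Bundle.Trivial M ℝ) (b := fun m : M ↦ m) hα hY
  simp only [mdifferentiableAt_totalSpace] at h
  exact h.2

/-- `X(α(Y)) - α([X, Y])` is tensorial in `Y`. -/
theorem tensorialAt_lieDerivOneFormAux (X : VecField E M) {α : OneForm E M} {x : M}
    (hα : DifferentiableOneFormAt α x) :
    TensorialAt 𝓘(ℝ, E) E (fun Y : VecField E M ↦ lieDerivOneFormAux X α Y x) x where
  smul {f Y} hf hY := by
    have h1 : (fun y ↦ α y ((f • Y) y)) = f * (fun y ↦ α y (Y y)) := by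
      funext y
      simp
    have h2 := VectorField.mlieBracket_smul_right (V := X) hf hY
    simp only [lieDerivOneFormAux, differential, h1, h2,
      mvfderiv_mul hf (mdifferentiableAt_apply hα hY)]
    simp
    ring
  add {Y Z} hY hZ := by
    have h1 : (fun y ↦ α y ((Y + Z) y)) = (fun y ↦ α y (Y y)) + (fun y ↦ α y (Z y)) := by
      funext y
      simp
    have h2 := VectorField.mlieBracket_add_right (V := X) hY hZ
    simp only [lieDerivOneFormAux, differential, h1, h2,
      mvfderiv_add (mdifferentiableAt_apply hα hY) (mdifferentiableAt_apply hα hZ)]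
    simp
    ring

open Classical in
/-- The Lie derivative `L_X α` of a one-form along a vector field, characterised by
`(L_X α)(Y) = X(α(Y)) - α([X, Y])` (see `lieDerivOneForm_apply`); it is given the value `0` at points
where `α` is not differentiable. -/
def lieDerivOneForm (X : VecField E M) (α : OneForm E M) : OneForm E M :=
  fun x ↦ if h : DifferentiableOneFormAt α x then
    TensorialAt.mkHom (fun Y : VecField E M ↦ lieDerivOneFormAux X α Y x) x
      (tensorialAt_lieDerivOneFormAux X h)
    else 0

theorem lieDerivOneForm_apply (X : VecField E M) {α : OneForm E M} {Y : VecField E M} {x : M}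
    (hα : DifferentiableOneFormAt α x) (hY : DifferentiableVecFieldAt Y x) :
    lieDerivOneForm X α x (Y x)
      = differential E (fun y ↦ α y (Y y)) x (X x)
        - α x (VectorField.mlieBracket 𝓘(ℝ, E) X Y x) := by
  rw [lieDerivOneForm, dif_pos hα]
  exact TensorialAt.mkHom_apply (tensorialAt_lieDerivOneFormAux X hα) hY

/-- The vector field `P_#(α)`. -/
def BivectorField.anchorField (P : BivectorField E M) (α : OneForm E M) : VecField E M :=
  fun x ↦ P.anchor x (α x)

/-- The Koszul bracket `[α, β]_P = L_{P_#(α)} β - L_{P_#(β)} α - d(P(α, β))`. -/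
def BivectorField.koszulBracket (P : BivectorField E M) (α β : OneForm E M) : OneForm E M :=
  fun x ↦ lieDerivOneForm (P.anchorField α) β x - lieDerivOneForm (P.anchorField β) α x
    - differential E (fun y ↦ P.form y (α y) (β y)) x

/-- `(L_X P)(α, β) = X(P(α, β)) - P(L_X α, β) - P(α, L_X β)`. -/
def BivectorField.lieDeriv (P : BivectorField E M) (X : VecField E M) (α β : OneForm E M) (x : M) :
    ℝ :=
  differential E (fun y ↦ P.form y (α y) (β y)) x (X x)
    - P.form x (lieDerivOneForm X α x) (β x) - P.form x (α x) (lieDerivOneForm X β x)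

/-- `X` is a Poisson vector field on `U`, i.e. `L_X P = 0` on `U`. -/
def BivectorField.IsPoissonVecFieldOn (P : BivectorField E M) (X : VecField E M) (U : Set M) :
    Prop :=
  ∀ α β : OneForm E M, SmoothOneFormOn α U → SmoothOneFormOn β U →
    ∀ x ∈ U, P.lieDeriv X α β x = 0

/-! ### The metric on covectors -/

variable (E M) in
/-- Smooth Riemannian metrics on `M`. -/
abbrev Metric : Type _ :=
  Bundle.ContMDiffRiemannianMetric 𝓘(ℝ, E) ∞ E (fun x : M ↦ TangentSpace 𝓘(ℝ, E) x)

theorem bijective_flat (g : Metric E M) (x : M) : Function.Bijective (g.inner x) := by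
  have hinj : Function.Injective (g.inner x) := by
    rw [injective_iff_map_eq_zero]
    intro v hv
    by_contra h
    have := g.pos x v h
    rw [hv] at this
    exact lt_irrefl _ this
  have : FiniteDimensional ℝ (TangentSpace 𝓘(ℝ, E) x) := inferInstanceAs (FiniteDimensional ℝ E)
  have hE : Module.finrank ℝ E = Module.finrank ℝ (E →L[ℝ] ℝ) := by
    rw [← Subspace.dual_finrank_eq (K := ℝ) (V := E)]
    exact LinearEquiv.finrank_eq (LinearMap.toContinuousLinearMap : (E →ₗ[ℝ] ℝ) ≃ₗ[ℝ] (E →L[ℝ] ℝ))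
  have : FiniteDimensional ℝ (E →L[ℝ] ℝ) := inferInstance
  have : FiniteDimensional ℝ (CotangentSpace E x) := this
  exact ⟨hinj, (LinearMap.injective_iff_surjective_of_finrank_eq_finrank
    (f := (g.inner x).toLinearMap) hE).1 hinj⟩

/-- The isomorphism `# : T*M → TM` of a Riemannian metric, characterised by `g(#α, v) = α(v)`. -/
def sharp (g : Metric E M) (x : M) : CotangentSpace E x ≃ₗ[ℝ] TangentSpace 𝓘(ℝ, E) x :=
  (LinearEquiv.ofBijective (g.inner x).toLinearMap (bijective_flat g x)).symm

theorem inner_sharp (g : Metric E M) (x : M) (α : CotangentSpace E x) :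
    g.inner x (sharp g x α) = α :=
  (LinearEquiv.ofBijective (g.inner x).toLinearMap (bijective_flat g x)).apply_symm_apply α

/-- The metric `⟨α, β⟩ = g(#α, #β)` on covectors. -/
def coinner (g : Metric E M) (x : M) (α β : CotangentSpace E x) : ℝ :=
  g.inner x (sharp g x α) (sharp g x β)

/-! ### Contravariant connections -/

/-- A contravariant connection on `T*M` with respect to a bivector field `P`: an operation
`(α, β) ↦ D_α β` on the smooth one-forms of `M` (its values on other arguments play no role). -/
structure ContravariantConnection (P : BivectorField E M) where
  /-- the operation `(α, β) ↦ D_α β` -/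
  D : OneForm E M → OneForm E M → OneForm E M
  smooth {α β : OneForm E M} (hα : SmoothOneFormOn α Set.univ) (hβ : SmoothOneFormOn β Set.univ) :
    SmoothOneFormOn (D α β) Set.univ
  add_left {α₁ α₂ β : OneForm E M} (hα₁ : SmoothOneFormOn α₁ Set.univ)
    (hα₂ : SmoothOneFormOn α₂ Set.univ) (hβ : SmoothOneFormOn β Set.univ) :
    D (α₁ + α₂) β = D α₁ β + D α₂ β
  smul_left {f : M → ℝ} {α β : OneForm E M} (hf : SmoothFunctionOn E f Set.univ)
    (hα : SmoothOneFormOn α Set.univ) (hβ : SmoothOneFormOn β Set.univ) :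
    D (fun x ↦ f x • α x) β = fun x ↦ f x • D α β x
  add_right {α β₁ β₂ : OneForm E M} (hα : SmoothOneFormOn α Set.univ)
    (hβ₁ : SmoothOneFormOn β₁ Set.univ) (hβ₂ : SmoothOneFormOn β₂ Set.univ) :
    D α (β₁ + β₂) = D α β₁ + D α β₂
  const_smul_right {c : ℝ} {α β : OneForm E M} (hα : SmoothOneFormOn α Set.univ)
    (hβ : SmoothOneFormOn β Set.univ) : D α (c • β) = c • D α β
  leibniz {f : M → ℝ} {α β : OneForm E M} (hf : SmoothFunctionOn E f Set.univ)
    (hα : SmoothOneFormOn α Set.univ) (hβ : SmoothOneFormOn β Set.univ) :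
    D α (fun x ↦ f x • β x)
      = fun x ↦ f x • D α β x + differential E f x (P.anchor x (α x)) • β x

/-- `D` is torsion-free: `D_α β - D_β α = [α, β]_P`. -/
def ContravariantConnection.IsTorsionFree {P : BivectorField E M}
    (D : ContravariantConnection P) : Prop :=
  ∀ α β : OneForm E M, SmoothOneFormOn α Set.univ → SmoothOneFormOn β Set.univ →
    D.D α β - D.D β α = P.koszulBracket α β

/-- The metric is parallel: `P_#(α)⟨β, γ⟩ = ⟨D_α β, γ⟩ + ⟨β, D_α γ⟩`. -/
def ContravariantConnection.Preserves {P : BivectorField E M}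
    (D : ContravariantConnection P) (g : Metric E M) : Prop :=
  ∀ α β γ : OneForm E M, SmoothOneFormOn α Set.univ → SmoothOneFormOn β Set.univ →
    SmoothOneFormOn γ Set.univ → ∀ x : M,
      differential E (fun y ↦ coinner g y (β y) (γ y)) x (P.anchor x (α x))
        = coinner g x (D.D α β x) (γ x) + coinner g x (β x) (D.D α γ x)

/-- `D` is the metric contravariant connection of `(P, g)`: the (unique) torsion-free contravariant
connection for which the metric is parallel. -/
def ContravariantConnection.IsMetricConnection {P : BivectorField E M}
    (D : ContravariantConnection P) (g : Metric E M) : Prop :=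
  D.Preserves g ∧ D.IsTorsionFree

/-- `D` is an `F`-connection: `P_#(α) = 0` implies `D_α = 0`. -/
def ContravariantConnection.IsFConnection {P : BivectorField E M}
    (D : ContravariantConnection P) : Prop :=
  ∀ α : OneForm E M, SmoothOneFormOn α Set.univ → (∀ x, P.anchor x (α x) = 0) →
    ∀ β : OneForm E M, SmoothOneFormOn β Set.univ → D.D α β = 0

/-! ### The symplectic foliation

The tangent space at `x` of the leaf of the symplectic foliation through `x` is the image of `P_#`
at `x`. -/

/-- The tangent distribution of the symplectic foliation. -/
def BivectorField.leafTangent (P : BivectorField E M) (x : M) :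
    Submodule ℝ (TangentSpace 𝓘(ℝ, E) x) :=
  LinearMap.range (P.anchor x)

/-- On `U`, the vector field `X` is tangent to the symplectic foliation. -/
def BivectorField.IsTangentOn (P : BivectorField E M) (X : VecField E M) (U : Set M) : Prop :=
  ∀ x ∈ U, X x ∈ P.leafTangent x

/-- On `U`, the vector field `X` is perpendicular to the symplectic foliation. -/
def BivectorField.IsPerpOn (P : BivectorField E M) (g : Metric E M) (X : VecField E M)
    (U : Set M) : Prop :=
  ∀ x ∈ U, ∀ v ∈ P.leafTangent x, g.inner x (X x) v = 0

/-- On `U`, the vector field `X` is foliated: for each smooth vector field `Y` on `U` tangent to the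
symplectic foliation, `[X, Y]` is tangent to it. -/
def BivectorField.IsFoliatedOn (P : BivectorField E M) (X : VecField E M) (U : Set M) : Prop :=
  ∀ Y : VecField E M, SmoothVectorFieldOn Y U → P.IsTangentOn Y U →
    P.IsTangentOn (VectorField.mlieBracket 𝓘(ℝ, E) X Y) U

/-- The metric is bundle-like for the symplectic foliation: for each open set `U` and all smooth
foliated vector fields `X`, `Y` on `U` perpendicular to the foliation, `g(X, Y)` is a Casimir function
on `U`, i.e. it is constant along the leaves in `U`. -/
def BivectorField.IsBundleLike (P : BivectorField E M) (g : Metric E M) : Prop :=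
  ∀ U : Set M, IsOpen U → ∀ X Y : VecField E M,
    SmoothVectorFieldOn X U → P.IsPerpOn g X U → P.IsFoliatedOn X U →
    SmoothVectorFieldOn Y U → P.IsPerpOn g Y U → P.IsFoliatedOn Y U →
    P.IsCasimirOn (fun x ↦ g.inner x (X x) (Y x)) U

end RiemannPoisson

end

noncomputable section

namespace RiemannPoisson

variable {E : Type*} [NormedAddCommGroup E] [NormedSpace ℝ E] [FiniteDimensional ℝ E]
  {M : Type*} [TopologicalSpace M] [ChartedSpace E M] [IsManifold 𝓘(ℝ, E) ∞ M]

/-! ### Cut-off functions and extension of one-forms -/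

/-! Everything rests on one identity. If `α` takes values in `Ker P_#`, then `D_α = 0` and `P(α, ·)
= 0`, so torsion-freeness reduces to `D_β α = L_{P_#β} α` (`apply_of_anchor_eq_zero`). By skewness
of `P`, `Ker P_#` is the annihilator of the leaves, and `X` is perpendicular to `F` exactly when
`g(X, ·)` lies in it.

Bundle-like: let `X`, `Y` be foliated and perpendicular, `h = g(X, Y)`, `Z = P_#γ`. Then `⟨D_γ X♭,
Y♭⟩ = (L_Z X♭)(Y) = Z(h) - X♭([Z, Y]) = Z(h)`, since `[Z, Y]` is tangent to the leaves. The same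
holds with `X` and `Y` exchanged, so parallelism of the metric gives `Z(h) = 2 Z(h)`.

Foliated implies Poisson: `(L_X P)(α, β) = β([X, P_#α]) - α([X, P_#β]) - X(P(α, β))` is tensorial
and alternating (`lieDeriv_eq`, `tensorialAt_lieDeriv`), and it vanishes when one argument lies in
`Ker P_#`, because `X` is foliated. Covectors split orthogonally as `Ker P_# ⊕ (Im P_#)♭`, so two
arguments `b`, `c` in the second summand remain. Since the leaves are involutive by the Jacobi
identity, `D` preserves that summand (`coinner_flat_anchorField`), whence `(D_b c)(X) = (D_c b)(X) =
0`. Torsion-freeness gives `[b, c]_P(X) = 0`, and as `b(X) = c(X) = 0` this is `(L_X P)(b, c) = 0`.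

Poisson implies foliated: for a section `η` of `Ker P_#`, `(L_X P)(η, γ) = 0` says that `L_X η`
kills `P_#γ`; evaluated on a tangent `Y` this is `η([X, Y]) = 0`. Constant rank enters through
`exists_smooth_anchor_eq_zero`, which extends a kernel covector to a smooth kernel section. -/

theorem exists_cutoff [T2Space M] {U : Set M} (hU : IsOpen U) {x : M} (hx : x ∈ U) :
    ∃ χ : M → ℝ, SmoothFunctionOn E χ Set.univ ∧ tsupport χ ⊆ U ∧ χ =ᶠ[𝓝 x] 1 := by
  obtain ⟨f, -, hf⟩ :=
    (SmoothBumpFunction.nhds_basis_tsupport (I := 𝓘(ℝ, E)) x).mem_iff.1 (hU.mem_nhds hx)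
  exact ⟨f, f.contMDiff.contMDiffOn, hf, f.eventuallyEq_one⟩

/-- The connection acts on global one-forms only, so local data have to be globalised. A pointwise
multiple by `χ` stays in any subspace that contains the values of `α`, in particular in `Ker P_#`.
-/
theorem SmoothOneFormOn.exists_extension [T2Space M] {α : OneForm E M} {U : Set M}
    (hα : SmoothOneFormOn α U) (hU : IsOpen U) {x : M} (hx : x ∈ U) :
    ∃ χ : M → ℝ, SmoothFunctionOn E χ Set.univ ∧ (∀ y ∉ U, χ y = 0) ∧ χ =ᶠ[𝓝 x] 1 ∧
      SmoothOneFormOn (fun y ↦ χ y • α y) Set.univ := by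
  obtain ⟨χ, h1, h2, h3⟩ := exists_cutoff (E := E) hU hx
  refine ⟨χ, h1, fun y hy ↦ image_eq_zero_of_notMem_tsupport fun h ↦ hy (h2 h), h3, ?_⟩
  exact (ContMDiffOn.smul_section_of_tsupport (ContMDiffOn.mono h1 (Set.subset_univ U)) hU h2
    hα).contMDiffOn

/-! ### Differentials and Lie brackets read in a chart. -/

theorem SmoothFunctionOn.differential {f : M → ℝ} {U : Set M} (hf : SmoothFunctionOn E f U)
    (hU : IsOpen U) : SmoothOneFormOn (differential E f) U := by
  intro x hx
  apply ContMDiffAt.contMDiffWithinAt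
  rw [contMDiffAt_hom_bundle]
  refine ⟨contMDiffAt_id, ?_⟩
  have h := (ContMDiffOn.contMDiffAt hf (hU.mem_nhds hx)).mfderiv_const (m := ∞) le_rfl
  refine h.congr_of_eventuallyEq ?_
  filter_upwards with y
  ext v
  simp [inTangentCoordinates, ContinuousLinearMap.inCoordinates, RiemannPoisson.differential]
  rfl

theorem smoothFunctionOn_comp_extChartAt (η : E →L[ℝ] ℝ) (x : M) :
    SmoothFunctionOn E (fun y ↦ η (extChartAt 𝓘(ℝ, E) x y)) (chartAt E x).source :=
  η.contMDiff.comp_contMDiffOn (contMDiffOn_extChartAt (n := ∞))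

theorem differential_comp_extChartAt (η : E →L[ℝ] ℝ) {x y : M} (hy : y ∈ (chartAt E x).source)
    (v : TangentSpace 𝓘(ℝ, E) y) :
    differential E (fun z ↦ η (extChartAt 𝓘(ℝ, E) x z)) y v
      = η (mfderiv 𝓘(ℝ, E) 𝓘(ℝ, E) (extChartAt 𝓘(ℝ, E) x) y v) := by
  have h := mvfderiv_comp_apply (I := 𝓘(ℝ, E)) (I' := 𝓘(ℝ, E)) y
    (g := η) (f := extChartAt 𝓘(ℝ, E) x) η.mdifferentiableAt
    (mdifferentiableAt_extChartAt hy) v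
  refine h.trans ?_
  simp [mvfderiv]
  rfl

theorem differential_congr {f h : M → ℝ} {x : M} (hfh : f =ᶠ[𝓝 x] h) :
    differential E f x = differential E h x := by
  ext v
  simp only [differential, mvfderiv, hfh.mfderiv_eq]
  rfl

/-- For a function linear in the chart, `df(Z)` is `η` applied to the coordinate expression of `Z`.
No second derivative of `f` appears, and the formula is `η` applied to the coordinate bracket `DW·V
- DV·W`. -/
theorem lieBracket_pairing {x : M} (η : E →L[ℝ] ℝ) {V W : VecField E M}
    (hV : DifferentiableVecFieldAt V x) (hW : DifferentiableVecFieldAt W x) {f : M → ℝ}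
    (hf : f =ᶠ[𝓝 x] fun y ↦ η (extChartAt 𝓘(ℝ, E) x y)) :
    differential E f x (VectorField.mlieBracket 𝓘(ℝ, E) V W x)
      = differential E (fun y ↦ differential E f y (W y)) x (V x)
        - differential E (fun y ↦ differential E f y (V y)) x (W x) := by
  have : CompleteSpace E := FiniteDimensional.complete ℝ E
  set φ := extChartAt 𝓘(ℝ, E) x with hφ
  have key : ∀ Z : VecField E M, DifferentiableVecFieldAt Z x → ∀ v : TangentSpace 𝓘(ℝ, E) x,
      differential E (fun y ↦ differential E f y (Z y)) x v
        = η (fderivWithin ℝ (VectorField.mpullbackWithin 𝓘(ℝ, E) 𝓘(ℝ, E) φ.symm Z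
            (Set.range 𝓘(ℝ, E))) (Set.range 𝓘(ℝ, E)) (φ x) v) := by
    intro Z hZ v
    set Z₀ : E → E := VectorField.mpullbackWithin 𝓘(ℝ, E) 𝓘(ℝ, E) φ.symm Z
            (Set.range 𝓘(ℝ, E)) with hZ₀
    have h1 : (fun y ↦ differential E f y (Z y)) =ᶠ[𝓝 x] (fun z ↦ η (Z₀ z)) ∘ φ := by
      -- Germ equality is needed at each nearby `y`, since differentials at `y` are compared.
      filter_upwards [hf.eventuallyEq_nhds, extChartAt_source_mem_nhds (I := 𝓘(ℝ, E)) x]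
        with y hy hys
      have hys' : y ∈ (chartAt E x).source := by rwa [extChartAt_source] at hys
      have e1 : differential E f y = differential E (fun z ↦ η (φ z)) y := by
        exact differential_congr hy
      rw [e1, differential_comp_extChartAt η hys']
      simp only [Function.comp_apply, hZ₀, VectorField.mpullbackWithin_apply]
      congr 1
      have A : φ.symm (φ y) = y := φ.left_inv hys
      have B := mfderivWithin_extChartAt_symm_comp_mfderiv_extChartAt' (I := 𝓘(ℝ, E)) hys
      have C := mfderiv_extChartAt_comp_mfderivWithin_extChartAt_symm' (I := 𝓘(ℝ, E)) hys
      have D : (mfderivWithin 𝓘(ℝ, E) 𝓘(ℝ, E) φ.symm (Set.range 𝓘(ℝ, E)) (φ y)).inverse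
        = mfderiv 𝓘(ℝ, E) 𝓘(ℝ, E) φ y := ContinuousLinearMap.inverse_eq B C
      rw [D, A]
    have h2 := MDifferentiableWithinAt.differentiableWithinAt_mpullbackWithin_vectorField
      (s := Set.univ) (V := Z) (x := x) (I := 𝓘(ℝ, E)) (mdifferentiableWithinAt_univ.2 hZ)
    have hu : (extChartAt 𝓘(ℝ, E) x).symm ⁻¹' Set.univ ∩ Set.range 𝓘(ℝ, E) = Set.univ := by simp
    have h3 : DifferentiableAt ℝ Z₀ (φ x) := by
      rw [hu] at h2
      exact differentiableWithinAt_univ.1 h2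
    have h4 : DifferentiableAt ℝ (fun z ↦ η (Z₀ z)) (φ x) := η.differentiableAt.comp _ h3
    have e1 : differential E (fun y ↦ differential E f y (Z y)) x
        = differential E ((fun z ↦ η (Z₀ z)) ∘ φ) x := by
      exact differential_congr h1
    rw [e1]
    have h5 := mvfderiv_comp_apply (I := 𝓘(ℝ, E)) (I' := 𝓘(ℝ, E)) x
      (g := fun z ↦ η (Z₀ z)) (f := φ) h4.mdifferentiableAt
      (mdifferentiableAt_extChartAt (mem_chart_source E x)) v
    refine h5.trans ?_
    rw [mfderiv_extChartAt_self]
    simp only [mvfderiv, mfderiv_eq_fderiv]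
    have h6 : fderiv ℝ (fun z ↦ η (Z₀ z)) (φ x) = η.comp (fderiv ℝ Z₀ (φ x)) :=
      (η.hasFDerivAt.comp _ h3.hasFDerivAt).fderiv
    have h7 : fderivWithin ℝ Z₀ (Set.range 𝓘(ℝ, E)) (φ x) = fderiv ℝ Z₀ (φ x) := by
      simp
    rw [h7]
    change fderiv ℝ (fun z ↦ η (Z₀ z)) (φ x) v = _
    rw [h6]
    rfl
  have e0 : differential E f x = η := by
    have e1 : differential E f x = differential E (fun z ↦ η (φ z)) x := by
      exact differential_congr hf
    ext v
    rw [e1, differential_comp_extChartAt η (mem_chart_source E x), mfderiv_extChartAt_self]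
    rfl
  have hval : ∀ Z : VecField E M, VectorField.mpullbackWithin 𝓘(ℝ, E) 𝓘(ℝ, E) φ.symm Z
            (Set.range 𝓘(ℝ, E)) (φ x) = Z x := by
    intro Z
    have h : ∀ y, y = x → (Z y : E) = (Z x : E) := by
      rintro _ rfl
      rfl
    exact (congrArg (fun w : E ↦ (mfderivWithin 𝓘(ℝ, E) 𝓘(ℝ, E) φ.symm (Set.range 𝓘(ℝ, E))
      (φ x)).inverse w) (h _ (extChartAt_to_inv x))).trans
      (mfderivWithin_extChartAt_symm_inverse_apply (Z x))
  have hbr : (VectorField.mlieBracket 𝓘(ℝ, E) V W x : E)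
      = VectorField.lieBracketWithin ℝ
        (VectorField.mpullbackWithin 𝓘(ℝ, E) 𝓘(ℝ, E) φ.symm V (Set.range 𝓘(ℝ, E)))
        (VectorField.mpullbackWithin 𝓘(ℝ, E) 𝓘(ℝ, E) φ.symm W (Set.range 𝓘(ℝ, E)))
        (Set.range 𝓘(ℝ, E)) (φ x) := by
    have h : ∀ w : E, (mfderiv 𝓘(ℝ, E) 𝓘(ℝ, E) φ x).inverse w = w := fun w ↦
      (congrArg (fun L : E →L[ℝ] E ↦ L.inverse w) mfderiv_extChartAt_self).trans
        (congrArg (fun L : E →L[ℝ] E ↦ L w) ContinuousLinearMap.inverse_id)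
    rw [← VectorField.mlieBracketWithin_univ, VectorField.mlieBracketWithin_apply,
      Set.preimage_univ, Set.univ_inter]
    exact h _
  rw [key W hW, key V hV, e0]
  refine (congrArg η hbr).trans ?_
  refine (map_sub η _ _).trans ?_
  rw [hval, hval]

/-- A chart-linear function, cut off near `x`. The chart centred at `x` has identity derivative
there, so its differential at `x` is `η` itself. -/
theorem exists_smooth_primitive [T2Space M] (x : M) (η : CotangentSpace E x) :
    ∃ f : M → ℝ, SmoothFunctionOn E f Set.univ ∧ differential E f x = η ∧
      ∀ V W : VecField E M, DifferentiableVecFieldAt V x → DifferentiableVecFieldAt W x →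
        η (VectorField.mlieBracket 𝓘(ℝ, E) V W x)
          = differential E (fun y ↦ differential E f y (W y)) x (V x)
            - differential E (fun y ↦ differential E f y (V y)) x (W x) := by
  obtain ⟨χ, h1, h2, h3⟩ := exists_cutoff (E := E) (chartAt E x).open_source (mem_chart_source E x)
  obtain ⟨η', rfl⟩ : ∃ η' : E →L[ℝ] ℝ, η' = η := ⟨η, rfl⟩
  set f : M → ℝ := fun y ↦ χ y • η' (extChartAt 𝓘(ℝ, E) x y) with hf
  have hfe : f =ᶠ[𝓝 x] fun y ↦ η' (extChartAt 𝓘(ℝ, E) x y) := by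
    filter_upwards [h3] with y hy
    simp [hf, hy]
  have e0 : differential E f x = η' := by
    ext v
    rw [differential_congr hfe, differential_comp_extChartAt η' (mem_chart_source E x),
      mfderiv_extChartAt_self]
    rfl
  refine ⟨f, ?_, e0, fun V W hV hW ↦ ?_⟩
  · refine ContMDiff.contMDiffOn (contMDiff_of_tsupport fun y hy ↦ ?_)
    have hy' : y ∈ (chartAt E x).source := h2 (tsupport_smul_subset_left _ _ hy)
    exact (h1.contMDiffAt Filter.univ_mem).smul
      ((smoothFunctionOn_comp_extChartAt η' x).contMDiffAt
        ((chartAt E x).open_source.mem_nhds hy'))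
  · rw [← lieBracket_pairing η' hV hW hfe, e0]

theorem exists_smooth_oneForm [T2Space M] (x : M) (η : CotangentSpace E x) :
    ∃ α : OneForm E M, SmoothOneFormOn α Set.univ ∧ α x = η := by
  obtain ⟨f, h1, h2, -⟩ := exists_smooth_primitive x η
  exact ⟨_, h1.differential isOpen_univ, h2⟩

/-! ### Regularity of vector fields tested on differentials of coordinates. -/

theorem localFrameCoeff_trivializationAt {ι : Type*} (b : Module.Basis ι ℝ E) (V : VecField E M)
    {x y : M} (hy : y ∈ (chartAt E x).source) (i : ι) :
    Bundle.Trivialization.localFrameCoeff 𝓘(ℝ, E)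
        (trivializationAt E (TangentSpace 𝓘(ℝ, E)) x) b i y (V y)
      = differential E (fun z ↦ LinearMap.toContinuousLinearMap (b.coord i)
          (extChartAt 𝓘(ℝ, E) x z)) y (V y) := by
  rw [differential_comp_extChartAt _ hy, ← TangentBundle.continuousLinearMapAt_trivializationAt hy]
  have hys : y ∈ (trivializationAt E (TangentSpace 𝓘(ℝ, E)) x).baseSet := hy
  refine (Bundle.Trivialization.localFrameCoeff_eq_coeff (I := 𝓘(ℝ, E))
    (trivializationAt E (TangentSpace 𝓘(ℝ, E)) x) (b := b) (s := V) hys (i := i)).trans ?_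
  have h : (trivializationAt E (TangentSpace 𝓘(ℝ, E)) x).continuousLinearMapAt ℝ y (V y)
      = (trivializationAt E (TangentSpace 𝓘(ℝ, E)) x ⟨y, V y⟩).2 := by
    rw [Bundle.Trivialization.continuousLinearMapAt_apply,
      Bundle.Trivialization.coe_linearMapAt_of_mem _ hys]
  exact congrArg (fun w ↦ b.repr w i) h.symm

/-- A vector field is smooth on an open set as soon as its pairing with each smooth one-form is. -/
theorem smoothVectorFieldOn_of_apply {V : VecField E M} {U : Set M}
    (hU : IsOpen U)
    (hV : ∀ (O : Set M) (f : M → ℝ), IsOpen O → SmoothFunctionOn E f O →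
      SmoothFunctionOn E (fun y ↦ differential E f y (V y)) (U ∩ O)) :
    SmoothVectorFieldOn V U := by
  intro x hx
  apply ContMDiffAt.contMDiffWithinAt
  let b := Module.finBasis ℝ E
  have hxs : x ∈ (trivializationAt E (TangentSpace 𝓘(ℝ, E)) x).baseSet :=
    FiberBundle.mem_baseSet_trivializationAt' x
  refine (contMDiffAt_iff_localFrameCoeff (I := 𝓘(ℝ, E))
    (e := trivializationAt E (TangentSpace 𝓘(ℝ, E)) x) b hxs).2 fun i ↦ ?_
  have h := hV _ _ (chartAt E x).open_source
    (smoothFunctionOn_comp_extChartAt (LinearMap.toContinuousLinearMap (b.coord i)) x)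
  have hn : U ∩ (chartAt E x).source ∈ 𝓝 x :=
    (hU.inter (chartAt E x).open_source).mem_nhds ⟨hx, mem_chart_source E x⟩
  refine (h.contMDiffAt hn).congr_of_eventuallyEq ?_
  filter_upwards [hn] with y hy
  exact localFrameCoeff_trivializationAt b V hy.2 i

theorem SmoothOneFormOn.apply {α : OneForm E M} {X : VecField E M} {U : Set M}
    (hα : SmoothOneFormOn α U) (hX : SmoothVectorFieldOn X U) :
    SmoothFunctionOn E (fun y ↦ α y (X y)) U := by
  have h : ContMDiffOn 𝓘(ℝ, E) (𝓘(ℝ, E).prod 𝓘(ℝ, ℝ)) ∞ (fun m : M ↦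
      Bundle.TotalSpace.mk' ℝ (E := Bundle.Trivial M ℝ) m (α m (X m))) U :=
    ContMDiffOn.clm_bundle_apply (E₂ := Bundle.Trivial M ℝ) (b := fun m : M ↦ m) hα hX
  intro x hx
  have := h x hx
  rw [Bundle.contMDiffWithinAt_totalSpace] at this
  exact this.2

theorem BivectorField.smooth_form_apply (P : BivectorField E M) {α β : OneForm E M} {U : Set M}
    (hα : SmoothOneFormOn α U) (hβ : SmoothOneFormOn β U) :
    SmoothFunctionOn E (fun y ↦ P.form y (α y) (β y)) U := by
  have h : ContMDiffOn 𝓘(ℝ, E) (𝓘(ℝ, E).prod 𝓘(ℝ, ℝ)) ∞ (fun m : M ↦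
      Bundle.TotalSpace.mk' ℝ (E := Bundle.Trivial M ℝ) m (P.form m (α m) (β m))) U :=
    ContMDiffOn.clm_bundle_apply₂ (E₃ := Bundle.Trivial M ℝ) (b := fun m : M ↦ m)
      P.smooth.contMDiffOn hα hβ
  intro x hx
  have := h x hx
  rw [Bundle.contMDiffWithinAt_totalSpace] at this
  exact this.2

theorem BivectorField.smooth_anchorField (P : BivectorField E M) {α : OneForm E M} {U : Set M}
    (hU : IsOpen U) (hα : SmoothOneFormOn α U) : SmoothVectorFieldOn (P.anchorField α) U := by
  refine smoothVectorFieldOn_of_apply hU fun O f hO hf ↦ ?_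
  simp only [anchorField, apply_anchor]
  exact P.smooth_form_apply (hα.mono Set.inter_subset_left)
    ((hf.differential hO).mono Set.inter_subset_right)

/-- The one-form `g(X, ·)`. -/
def flatField (g : Metric E M) (X : VecField E M) : OneForm E M :=
  fun y ↦ g.inner y (X y)

theorem smooth_flatField (g : Metric E M) {X : VecField E M} {U : Set M}
    (hX : SmoothVectorFieldOn X U) : SmoothOneFormOn (flatField g X) U :=
  ContMDiffOn.clm_bundle_apply (b := fun m : M ↦ m) g.contMDiff.contMDiffOn hX

/-! ### Kernels of constant rank -/

/-- A smooth family of linear maps of constant rank: each vector in the kernel at a point extends to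
a smooth local section of the kernels. -/
theorem exists_smooth_kernel_section {F₁ F₂ : Type*} [NormedAddCommGroup F₁] [NormedSpace ℝ F₁]
    [FiniteDimensional ℝ F₁] [NormedAddCommGroup F₂] [NormedSpace ℝ F₂] [FiniteDimensional ℝ F₂]
    {A : M → F₁ →L[ℝ] F₂} {U : Set M} (hU : IsOpen U)
    (hA : ContMDiffOn 𝓘(ℝ, E) 𝓘(ℝ, F₁ →L[ℝ] F₂) ∞ A U) {x : M} (hx : x ∈ U)
    (hrank : ∀ y ∈ U, Module.finrank ℝ (LinearMap.range (A y : F₁ →ₗ[ℝ] F₂))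
      = Module.finrank ℝ (LinearMap.range (A x : F₁ →ₗ[ℝ] F₂)))
    {c₀ : F₁} (hc₀ : A x c₀ = 0) :
    ∃ (O : Set M) (c : M → F₁), IsOpen O ∧ x ∈ O ∧ O ⊆ U ∧
      ContMDiffOn 𝓘(ℝ, E) 𝓘(ℝ, F₁) ∞ c O ∧ (∀ y ∈ O, A y (c y) = 0) ∧ c x = c₀ := by
  have : CompleteSpace F₁ := FiniteDimensional.complete ℝ F₁
  set K : Submodule ℝ F₁ := LinearMap.ker (A x : F₁ →ₗ[ℝ] F₂) with hK
  obtain ⟨C, hKC⟩ := K.exists_isCompl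
  obtain ⟨G, hG⟩ := LinearMap.exists_leftInverse_of_injective
    ((A x : F₁ →ₗ[ℝ] F₂) ∘ₗ C.subtype) (by
      rw [LinearMap.ker_eq_bot']
      rintro ⟨u, hu⟩ h
      have h1 : u ∈ K ⊓ C := ⟨h, hu⟩
      rw [hKC.inf_eq_bot] at h1
      exact Subtype.ext h1)
  set p : F₁ →ₗ[ℝ] F₁ := K.subtype ∘ₗ Submodule.projectionOnto K C hKC with hp
  have hpK : ∀ u ∈ K, p u = u := fun u hu ↦ by
    exact congrArg Subtype.val (Submodule.projectionOnto_apply_left hKC ⟨u, hu⟩)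
  have hpC : ∀ u ∈ C, p u = 0 := fun u hu ↦ by
    exact congrArg Subtype.val (Submodule.projectionOnto_apply_right hKC ⟨u, hu⟩)
  set B : F₂ →L[ℝ] F₁ := LinearMap.toContinuousLinearMap (C.subtype ∘ₗ G) with hB
  have hBapp : ∀ w, B w = (G w : F₁) := fun w ↦ rfl
  set pc : F₁ →L[ℝ] F₁ := LinearMap.toContinuousLinearMap p with hpc
  have hpcapp : ∀ w, pc w = p w := fun w ↦ rfl
  -- `B` inverts `A x` on the complement `C`, and `pc` projects onto `K` along `C`. Thus `L x = 1`,
  -- `L y` is invertible near `x`, and the section is `L(y)⁻¹ c₀`.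
  set L : M → F₁ →L[ℝ] F₁ := fun y ↦ B ∘L A y + pc with hL
  have hLsmooth : ContMDiffOn 𝓘(ℝ, E) 𝓘(ℝ, F₁ →L[ℝ] F₁) ∞ L U :=
    (contMDiffOn_const.clm_comp hA).add contMDiffOn_const
  have hLx : L x = 1 := by
    ext u
    obtain ⟨k, hk, d, hd, rfl⟩ := Submodule.mem_sup.1
      (hKC.sup_eq_top ▸ Submodule.mem_top : u ∈ K ⊔ C)
    have h1 : A x k = 0 := hk
    have h2 : (G (A x d) : F₁) = d :=
      congrArg Subtype.val (LinearMap.congr_fun hG ⟨d, hd⟩)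
    simp [hL, hBapp, hpcapp, h1, h2, hpK k hk, hpC d hd, add_comm]
  set O : Set M := U ∩ L ⁻¹' {T | IsUnit T} with hO
  have hOopen : IsOpen O :=
    hLsmooth.continuousOn.isOpen_inter_preimage hU Units.isOpen
  refine ⟨O, fun y ↦ Ring.inverse (L y) c₀, hOopen, ⟨hx, ?_⟩, Set.inter_subset_left, ?_, ?_, ?_⟩
  · simp [hLx]
  · intro y hy
    obtain ⟨T, hT⟩ := hy.2
    have h1 : ContDiffAt ℝ ∞ Ring.inverse (L y) := hT ▸ contDiffAt_ringInverse ℝ T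
    have h2 : ContMDiffWithinAt 𝓘(ℝ, E) 𝓘(ℝ, F₁ →L[ℝ] F₁) ∞ (fun y ↦ Ring.inverse (L y)) O y :=
      h1.contMDiffAt.comp_contMDiffWithinAt y ((hLsmooth y hy.1).mono Set.inter_subset_left)
    exact h2.clm_apply contMDiffWithinAt_const
  · intro y hy
    have hLinj : ∀ u, L y u = 0 → u = 0 := fun u hu ↦ by
      have h := congrArg (fun T : F₁ →L[ℝ] F₁ ↦ T u) (Ring.inverse_mul_cancel _ hy.2)
      simpa [hu] using h.symm
    set c := Ring.inverse (L y) c₀ with hc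
    have h1 : L y c = c₀ :=
      congrArg (fun T : F₁ →L[ℝ] F₁ ↦ T c₀) (Ring.mul_inverse_cancel _ hy.2)
    -- Apply `p` to `L y c = c₀`: the values of `B` lie in `C`, where `p` vanishes.
    have h2 : p c = c₀ := by
      have h3 := congrArg p h1
      rw [hpK c₀ hc₀] at h3
      have h4 : p (L y c) = p (p c) := by
        simp [hL, hBapp, hpcapp, hpC _ (G (A y c)).2]
      rw [h4, hpK (p c) (Submodule.projectionOnto K C hKC c).2] at h3
      exact h3
    have h3 : B (A y c) = 0 := by
      have h4 : L y c = B (A y c) + p c := rfl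
      rw [h1, h2] at h4
      simpa using h4.symm
    have hinj : Function.Injective ((A y : F₁ →ₗ[ℝ] F₂) ∘ₗ C.subtype) := by
      rw [← LinearMap.ker_eq_bot, LinearMap.ker_eq_bot']
      rintro ⟨u, hu⟩ h
      refine Subtype.ext (hLinj u ?_)
      have h4 : A y u = 0 := h
      simp [hL, hpcapp, h4, hpC u hu]
    -- Constant rank: `A y` is injective on `C`, whose dimension is the rank of `A x`, so `A y` maps
    -- `C` onto its whole range. Then `A y c = A y d` with `d` in `C`, and `L y d = B (A y c) = 0`
    -- forces `d = 0`.
    have hr : LinearMap.range ((A y : F₁ →ₗ[ℝ] F₂) ∘ₗ C.subtype)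
        = LinearMap.range (A y : F₁ →ₗ[ℝ] F₂) := by
      refine Submodule.eq_of_le_of_finrank_eq (LinearMap.range_comp_le_range _ _) ?_
      rw [LinearMap.finrank_range_of_inj hinj, hrank y hy.1]
      have e1 := Submodule.finrank_add_eq_of_isCompl hKC
      have e2 := LinearMap.finrank_range_add_finrank_ker (A x : F₁ →ₗ[ℝ] F₂)
      rw [← hK] at e2
      omega
    obtain ⟨d, hd⟩ : A y c ∈ LinearMap.range ((A y : F₁ →ₗ[ℝ] F₂) ∘ₗ C.subtype) :=
      hr ▸ LinearMap.mem_range_self (A y : F₁ →ₗ[ℝ] F₂) c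
    have hd' : A y (d : F₁) = A y c := hd
    have h5 : (d : F₁) = 0 := hLinj d (by simp [hL, hpcapp, hd', h3, hpC d d.2])
    rw [← hd', h5, map_zero]
  · simp [hLx]

theorem eq_zero_of_forall_basis_apply {ι : Type*} {y : M}
    (b : Module.Basis ι ℝ (CotangentSpace E y)) {v : TangentSpace 𝓘(ℝ, E) y}
    (h : ∀ i, b i v = 0) : v = 0 := by
  have h1 : ∀ φ : CotangentSpace E y, φ v = 0 := fun φ ↦ by
    have h2 : φ ∈ Submodule.span ℝ (Set.range b) := b.mem_span φ
    induction h2 using Submodule.span_induction with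
    | mem φ hφ =>
      obtain ⟨i, rfl⟩ := hφ
      exact h i
    | zero => rfl
    | add φ ψ _ _ h3 h4 => simp [h3, h4]
    | smul c φ _ h3 => simp [h3]
  exact (Module.forall_dual_apply_eq_zero_iff ℝ (v : E)).1 fun φ ↦
    h1 (LinearMap.toContinuousLinearMap φ : E →L[ℝ] ℝ)

theorem BivectorField.exists_smooth_anchor_eq_zero [T2Space M] {P : BivectorField E M}
    (hreg : P.IsRegular) {x : M} {η : CotangentSpace E x} (hη : P.anchor x η = 0) :
    ∃ α : OneForm E M, SmoothOneFormOn α Set.univ ∧ (∀ y, P.anchor y (α y) = 0) ∧ α x = η := by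
  classical
  set e := trivializationAt (E →L[ℝ] ℝ) (fun x : M ↦ CotangentSpace E x) x with he
  obtain ⟨n, ⟨b⟩⟩ : ∃ n, Nonempty (Module.Basis (Fin n) ℝ (E →L[ℝ] ℝ)) :=
    ⟨_, ⟨Module.finBasis ℝ (E →L[ℝ] ℝ)⟩⟩
  set θ : Fin n → OneForm E M := e.localFrame b with hθ
  have hxe : x ∈ e.baseSet := FiberBundle.mem_baseSet_trivializationAt' x
  have hθs : ∀ i, SmoothOneFormOn (θ i) e.baseSet := fun i ↦
    e.contMDiffOn_localFrame_baseSet (I := 𝓘(ℝ, E)) ∞ b i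
  let b' : ∀ y, y ∈ e.baseSet → Module.Basis (Fin n) ℝ (CotangentSpace E y) := fun y hy ↦
    e.basisAt b hy
  have hb' : ∀ y hy i, b' y hy i = θ i y := fun y hy i ↦
    (e.localFrame_apply_of_mem_baseSet b hy).symm
  let unit : Fin n → Fin n → (Fin n → ℝ) →L[ℝ] (Fin n → ℝ) := fun i j ↦
    (ContinuousLinearMap.proj i : (Fin n → ℝ) →L[ℝ] ℝ).smulRight (Pi.single j (1 : ℝ))
  -- The matrix of `P` in a local coframe; its rank is that of the anchor and its kernel consists of
  -- the coordinates of `Ker P_#`.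
  let A : M → (Fin n → ℝ) →L[ℝ] (Fin n → ℝ) := fun y ↦
    ∑ i, ∑ j, P.form y (θ i y) (θ j y) • unit i j
  have hAapp : ∀ y c j, A y c j = θ j y (P.anchor y (∑ i, c i • θ i y)) := by
    intro y c j
    simp only [A, unit, P.apply_anchor]
    simp [Finset.sum_apply, Pi.single_apply, mul_comm]
  have hA : ContMDiffOn 𝓘(ℝ, E) 𝓘(ℝ, (Fin n → ℝ) →L[ℝ] (Fin n → ℝ)) ∞ A e.baseSet := by
    refine contMDiffOn_finsetSum fun i _ ↦ contMDiffOn_finsetSum fun j _ ↦ ?_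
    exact ContMDiffOn.smul (P.smooth_form_apply (hθs i) (hθs j)) contMDiffOn_const
  have hrank : ∀ y ∈ e.baseSet,
      Module.finrank ℝ (LinearMap.range (A y : (Fin n → ℝ) →ₗ[ℝ] (Fin n → ℝ))) = P.rank y := by
    intro y hy
    let Φ : TangentSpace 𝓘(ℝ, E) y →ₗ[ℝ] (Fin n → ℝ) :=
      LinearMap.pi fun j ↦ (θ j y).toLinearMap
    have hΦ : Function.Injective Φ := by
      rw [injective_iff_map_eq_zero]
      intro v hv
      refine eq_zero_of_forall_basis_apply (b' y hy) fun j ↦ ?_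
      rw [hb']
      exact congrFun hv j
    have hfac : (A y : (Fin n → ℝ) →ₗ[ℝ] (Fin n → ℝ))
        = Φ ∘ₗ P.anchor y ∘ₗ (b' y hy).equivFun.symm.toLinearMap := by
      refine LinearMap.ext fun c ↦ funext fun j ↦ ?_
      refine (hAapp y c j).trans ?_
      simp only [LinearMap.comp_apply, LinearEquiv.coe_coe, Module.Basis.equivFun_symm_apply, hb']
      rfl
    rw [hfac, LinearMap.range_comp, LinearMap.range_comp, LinearEquiv.range, Submodule.map_top]
    exact (Submodule.equivMapOfInjective Φ hΦ _).finrank_eq.symm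
  have hc₀ : A x ((b' x hxe).equivFun η) = 0 := by
    funext j
    rw [hAapp]
    have : ∑ i, (b' x hxe).equivFun η i • θ i x = η := by
      simp only [← hb' x hxe]
      exact (b' x hxe).sum_equivFun η
    rw [this, hη, map_zero]
    rfl
  obtain ⟨O, c, hO, hxO, hOe, hcs, hc, hcx⟩ := exists_smooth_kernel_section e.open_baseSet hA hxe
    (fun y hy ↦ (hrank y hy).trans ((hreg y x).trans (hrank x hxe).symm)) hc₀
  set α : OneForm E M := fun y ↦ ∑ i, c y i • θ i y with hα
  have hαs : SmoothOneFormOn α O := by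
    refine ContMDiffOn.sum_section fun i _ ↦ ?_
    exact ContMDiffOn.smul_section ((contMDiffOn_pi_space.1 hcs) i) ((hθs i).mono hOe)
  have hαK : ∀ y ∈ O, P.anchor y (α y) = 0 := by
    intro y hy
    refine eq_zero_of_forall_basis_apply (b' y (hOe hy)) fun j ↦ ?_
    rw [hb', hα, ← hAapp, hc y hy]
    rfl
  have hαx : α x = η := by
    simp only [hα, hcx, ← hb' x hxe]
    exact (b' x hxe).sum_equivFun η
  obtain ⟨χ, -, h2, h3, h4⟩ := hαs.exists_extension hO hxO
  refine ⟨_, h4, fun y ↦ ?_, ?_⟩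
  · by_cases hy : y ∈ O
    · rw [map_smul, hαK y hy, smul_zero]
    · rw [h2 y hy, zero_smul, map_zero]
  · simp [h3.self_of_nhds, hαx]

/-! ### Differentiability -/

theorem SmoothOneFormOn.differentiableAt {α : OneForm E M} {U : Set M} (hα : SmoothOneFormOn α U)
    (hU : IsOpen U) {x : M} (hx : x ∈ U) : DifferentiableOneFormAt α x :=
  (ContMDiffOn.contMDiffAt hα (hU.mem_nhds hx)).mdifferentiableAt (by simp)

theorem SmoothOneFormOn.differentiable {α : OneForm E M} (hα : SmoothOneFormOn α Set.univ) (x : M) :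
    DifferentiableOneFormAt α x :=
  hα.differentiableAt isOpen_univ (Set.mem_univ x)

theorem SmoothVectorFieldOn.differentiableAt {X : VecField E M} {U : Set M}
    (hX : SmoothVectorFieldOn X U) (hU : IsOpen U) {x : M} (hx : x ∈ U) :
    DifferentiableVecFieldAt X x :=
  (ContMDiffOn.contMDiffAt hX (hU.mem_nhds hx)).mdifferentiableAt (by simp)

theorem BivectorField.mdifferentiableAt_form_apply (P : BivectorField E M) {α β : OneForm E M}
    {x : M} (hα : DifferentiableOneFormAt α x) (hβ : DifferentiableOneFormAt β x) :
    MDifferentiableAt 𝓘(ℝ, E) 𝓘(ℝ, ℝ) (fun y ↦ P.form y (α y) (β y)) x := by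
  have h : MDifferentiableAt 𝓘(ℝ, E) (𝓘(ℝ, E).prod 𝓘(ℝ, ℝ)) (fun m : M ↦
      Bundle.TotalSpace.mk' ℝ (E := Bundle.Trivial M ℝ) m (P.form m (α m) (β m))) x :=
    MDifferentiableAt.clm_bundle_apply₂ (E₃ := Bundle.Trivial M ℝ) (b := fun m : M ↦ m)
      ((P.smooth x).mdifferentiableAt (by simp)) hα hβ
  simp only [mdifferentiableAt_totalSpace] at h
  exact h.2

/-- Tensoriality at `x` is tested on one-forms merely differentiable at `x`, so smoothness of
`anchorField` does not suffice. -/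
theorem DifferentiableOneFormAt.anchorField (P : BivectorField E M) {α : OneForm E M} {x : M}
    (hα : DifferentiableOneFormAt α x) : DifferentiableVecFieldAt (P.anchorField α) x := by
  let b := Module.finBasis ℝ E
  have hxs : x ∈ (trivializationAt E (TangentSpace 𝓘(ℝ, E)) x).baseSet :=
    FiberBundle.mem_baseSet_trivializationAt' x
  refine (mdifferentiableAt_iff_localFrameCoeff (I := 𝓘(ℝ, E))
    (e := trivializationAt E (TangentSpace 𝓘(ℝ, E)) x) b hxs).2 fun i ↦ ?_
  have hx := mem_chart_source E x
  have ho := (chartAt E x).open_source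
  have h := P.mdifferentiableAt_form_apply hα
    (((smoothFunctionOn_comp_extChartAt (LinearMap.toContinuousLinearMap (b.coord i)) x).differential
      ho).differentiableAt ho hx)
  refine h.congr_of_eventuallyEq ?_
  filter_upwards [ho.mem_nhds hx] with y hy
  rw [← P.apply_anchor]
  exact localFrameCoeff_trivializationAt b (P.anchorField α) hy i

/-! ### Linear algebra of the anchor map -/

namespace BivectorField

variable (P : BivectorField E M)

theorem form_swap (x : M) (α β : CotangentSpace E x) : P.form x α β = -P.form x β α := by
  have h := P.alternating x (α + β)
  simp only [map_add, add_apply, P.alternating] at h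
  linarith

theorem form_of_anchor_eq_zero {x : M} {α : CotangentSpace E x} (hα : P.anchor x α = 0)
    (β : CotangentSpace E x) : P.form x α β = 0 := by
  rw [← P.apply_anchor, hα, map_zero]

theorem anchor_eq_zero {x : M} {η : CotangentSpace E x}
    (h : ∀ γ : CotangentSpace E x, η (P.anchor x γ) = 0) : P.anchor x η = 0 := by
  refine (Module.forall_dual_apply_eq_zero_iff ℝ (P.anchor x η : E)).1 fun φ ↦ ?_
  let ψ : CotangentSpace E x := (LinearMap.toContinuousLinearMap φ : E →L[ℝ] ℝ)
  have h1 := h ψ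
  rw [P.apply_anchor, P.form_swap, neg_eq_zero, ← P.apply_anchor] at h1
  exact h1

theorem apply_of_mem_leafTangent {x : M} {η : CotangentSpace E x} (hη : P.anchor x η = 0)
    {v : TangentSpace 𝓘(ℝ, E) x} (hv : v ∈ P.leafTangent x) : η v = 0 := by
  obtain ⟨γ, rfl⟩ := hv
  rw [P.apply_anchor, P.form_swap, P.form_of_anchor_eq_zero hη, neg_zero]

theorem anchor_mem_leafTangent (x : M) (γ : CotangentSpace E x) :
    P.anchor x γ ∈ P.leafTangent x :=
  LinearMap.mem_range_self (P.anchor x) γ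

/-- Double annihilator: a functional separating `v` from the image of the anchor kills that image,
hence lies in the kernel by skewness. -/
theorem mem_leafTangent {x : M} {v : TangentSpace 𝓘(ℝ, E) x}
    (h : ∀ η : CotangentSpace E x, P.anchor x η = 0 → η v = 0) : v ∈ P.leafTangent x := by
  by_contra hv
  have : FiniteDimensional ℝ (TangentSpace 𝓘(ℝ, E) x) := inferInstanceAs (FiniteDimensional ℝ E)
  obtain ⟨φ, hφ, hφ'⟩ := Submodule.exists_dual_map_eq_bot_of_notMem hv inferInstance
  let η : CotangentSpace E x := (LinearMap.toContinuousLinearMap (φ : E →ₗ[ℝ] ℝ) : E →L[ℝ] ℝ)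
  refine hφ (h η (P.anchor_eq_zero fun γ ↦ ?_))
  have h1 : φ (P.anchor x γ) ∈ Submodule.map φ (P.leafTangent x) :=
    Submodule.mem_map_of_mem (P.anchor_mem_leafTangent x γ)
  rw [hφ'] at h1
  exact h1

end BivectorField

/-! ### Musical isomorphisms -/

theorem sharp_inner (g : Metric E M) (x : M) (v : TangentSpace 𝓘(ℝ, E) x) :
    sharp g x (g.inner x v) = v :=
  (LinearEquiv.ofBijective (g.inner x).toLinearMap (bijective_flat g x)).symm_apply_apply v

theorem coinner_inner_right (g : Metric E M) (x : M) (α : CotangentSpace E x)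
    (v : TangentSpace 𝓘(ℝ, E) x) : coinner g x α (g.inner x v) = α v := by
  rw [coinner, sharp_inner, inner_sharp]

theorem coinner_comm (g : Metric E M) (x : M) (α β : CotangentSpace E x) :
    coinner g x α β = coinner g x β α :=
  g.symm x _ _

/-- A covector splits orthogonally along the kernel of the anchor map. -/
theorem BivectorField.exists_eq_add_flat_anchor (P : BivectorField E M) (g : Metric E M) (x : M)
    (φ : CotangentSpace E x) :
    ∃ κ γ : CotangentSpace E x, P.anchor x κ = 0 ∧ φ = κ + g.inner x (P.anchor x γ) := by
  have : FiniteDimensional ℝ (TangentSpace 𝓘(ℝ, E) x) := inferInstanceAs (FiniteDimensional ℝ E)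
  -- `S` is `g`-skew, so `g(Sv, Sv) = -g(v, S(Sv))`. Its kernel and range therefore meet trivially
  -- and are complementary by dimension.
  let S : TangentSpace 𝓘(ℝ, E) x →ₗ[ℝ] TangentSpace 𝓘(ℝ, E) x :=
    P.anchor x ∘ₗ (g.inner x).toLinearMap
  have hS : ∀ v, S v = P.anchor x (g.inner x v) := fun v ↦ rfl
  have hskew : ∀ v w, g.inner x v (S w) = -g.inner x w (S v) := fun v w ↦ by
    rw [hS, hS, P.apply_anchor, P.form_swap, P.apply_anchor]
  have hdisj : Disjoint (LinearMap.ker S) (LinearMap.range S) := by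
    rw [Submodule.disjoint_def]
    rintro _ hw ⟨v, rfl⟩
    by_contra hne
    have h1 := g.pos x (S v) hne
    have h2 : S (S v) = 0 := hw
    rw [hskew, h2, map_zero, neg_zero] at h1
    exact lt_irrefl _ h1
  have hcompl : IsCompl (LinearMap.ker S) (LinearMap.range S) :=
    (Submodule.isCompl_iff_disjoint _ _ (by
      rw [add_comm, LinearMap.finrank_range_add_finrank_ker])).2 hdisj
  obtain ⟨v, hv, w, ⟨u, rfl⟩, huv⟩ := Submodule.mem_sup.1
    (hcompl.sup_eq_top ▸ Submodule.mem_top : sharp g x φ ∈ LinearMap.ker S ⊔ LinearMap.range S)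
  refine ⟨g.inner x v, g.inner x u, hv, ?_⟩
  rw [← inner_sharp g x φ, ← huv, map_add]
  rfl

/-! ### Bracket formulas -/

/-- The Leibniz error term is a multiple of `P_#α`, which `η` kills. This lets `α` be replaced by an
exact form with the same value at `x`. -/
theorem tensorialAt_apply_mlieBracket_anchorField (P : BivectorField E M) {x : M}
    {η : CotangentSpace E x} (hη : P.anchor x η = 0) (Z : VecField E M) :
    TensorialAt 𝓘(ℝ, E) (E →L[ℝ] ℝ) (fun α : OneForm E M ↦
      η (VectorField.mlieBracket 𝓘(ℝ, E) (P.anchorField α) Z x)) x where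
  smul {f α} hf hα := by
    have h1 : P.anchorField (f • α) = f • P.anchorField α := by
      funext y
      simp [BivectorField.anchorField]
    rw [h1, VectorField.mlieBracket_smul_left hf (DifferentiableOneFormAt.anchorField P hα)]
    have h2 : η (P.anchorField α x) = 0 :=
      P.apply_of_mem_leafTangent hη (P.anchor_mem_leafTangent x _)
    simp [h2]
  add {α β} hα hβ := by
    have h1 : P.anchorField (α + β) = P.anchorField α + P.anchorField β := by
      funext y
      simp [BivectorField.anchorField]
    rw [h1, VectorField.mlieBracket_add_left (DifferentiableOneFormAt.anchorField P hα)
      (DifferentiableOneFormAt.anchorField P hβ), map_add]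

theorem differential_neg (f : M → ℝ) (x : M) :
    differential E (fun y ↦ -f y) x = -differential E f x :=
  mvfderiv_neg

theorem differential_const (c : ℝ) (x : M) : differential E (fun _ : M ↦ c) x = 0 :=
  mvfderiv_const c

/-- The tangent distribution of the symplectic foliation is involutive. -/
theorem BivectorField.IsPoisson.mlieBracket_mem_leafTangent [T2Space M] {P : BivectorField E M}
    (hP : P.IsPoisson) {α β : OneForm E M} {x : M} (hα : DifferentiableOneFormAt α x)
    (hβ : DifferentiableOneFormAt β x) :
    VectorField.mlieBracket 𝓘(ℝ, E) (P.anchorField α) (P.anchorField β) x ∈ P.leafTangent x := by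
  refine P.mem_leafTangent fun η hη ↦ ?_
  obtain ⟨a, has, hax, -⟩ := exists_smooth_primitive x (α x)
  obtain ⟨b, hbs, hbx, -⟩ := exists_smooth_primitive x (β x)
  obtain ⟨k, hks, hkx, hk⟩ := exists_smooth_primitive x η
  have hda := (has.differential isOpen_univ).differentiable x
  have hdb := (hbs.differential isOpen_univ).differentiable x
  have e1 := (tensorialAt_apply_mlieBracket_anchorField P hη (P.anchorField β)).pointwise
    hα hda hax.symm
  have e2 := (tensorialAt_apply_mlieBracket_anchorField P hη
    (P.anchorField (differential E a))).pointwise hβ hdb hbx.symm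
  have e3 := hk _ _ (hda.anchorField P) (hdb.anchorField P)
  have e4 : η (VectorField.mlieBracket 𝓘(ℝ, E) (P.anchorField α) (P.anchorField β) x)
      = η (VectorField.mlieBracket 𝓘(ℝ, E) (P.anchorField (differential E a))
          (P.anchorField (differential E b)) x) := by
    refine e1.trans ?_
    rw [VectorField.mlieBracket_swap_apply, map_neg]
    rw [VectorField.mlieBracket_swap_apply (V := P.anchorField (differential E a)), map_neg]
    exact congrArg Neg.neg e2
  have e5 : ∀ c : M → ℝ, (fun y ↦ differential E k y (P.anchorField (differential E c) y))
      = P.bracket c k := fun c ↦ by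
    funext y
    exact P.apply_anchor y _ _
  rw [e4, e3, e5, e5]
  have e6 : ∀ c f : M → ℝ, differential E f x (P.anchorField (differential E c) x)
      = P.bracket c f x := fun c f ↦ P.apply_anchor x _ _
  rw [e6, e6]
  -- `η([H_a, H_b]) = {a, {b, k}} - {b, {a, k}}`, which Jacobi turns into `-{k, {a, b}}`; this
  -- vanishes at `x` because `dk = η` there.
  have hJ := hP a b k has hbs hks x
  have e7 : P.bracket k a = fun y ↦ -P.bracket a k y := by
    funext y
    exact P.form_swap y _ _
  have e8 : P.bracket b (P.bracket k a) x = -P.bracket b (P.bracket a k) x := by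
    rw [e7]
    simp only [BivectorField.bracket]
    rw [differential_neg, map_neg]
    rfl
  have e9 : P.bracket k (P.bracket a b) x = 0 := by
    rw [BivectorField.bracket, hkx]
    exact P.form_of_anchor_eq_zero hη _
  rw [e8, e9] at hJ
  linarith

theorem BivectorField.koszulBracket_apply (P : BivectorField E M) {α β : OneForm E M} {x : M}
    {Y : VecField E M} (hα : DifferentiableOneFormAt α x) (hβ : DifferentiableOneFormAt β x)
    (hY : DifferentiableVecFieldAt Y x) :
    P.koszulBracket α β x (Y x)
      = (differential E (fun y ↦ β y (Y y)) x (P.anchorField α x)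
          - β x (VectorField.mlieBracket 𝓘(ℝ, E) (P.anchorField α) Y x))
        - (differential E (fun y ↦ α y (Y y)) x (P.anchorField β x)
          - α x (VectorField.mlieBracket 𝓘(ℝ, E) (P.anchorField β) Y x))
        - differential E (fun y ↦ P.form y (α y) (β y)) x (Y x) := by
  simp only [koszulBracket, sub_apply, lieDerivOneForm_apply _ hα hY,
    lieDerivOneForm_apply _ hβ hY]

theorem BivectorField.lieDeriv_eq (P : BivectorField E M) {X : VecField E M} {α β : OneForm E M}
    {x : M} (hα : DifferentiableOneFormAt α x) (hβ : DifferentiableOneFormAt β x) :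
    P.lieDeriv X α β x
      = β x (VectorField.mlieBracket 𝓘(ℝ, E) X (P.anchorField α) x)
        - α x (VectorField.mlieBracket 𝓘(ℝ, E) X (P.anchorField β) x)
        - differential E (fun y ↦ P.form y (α y) (β y)) x (X x) := by
  have e1 : P.form x (lieDerivOneForm X α x) (β x)
      = -lieDerivOneForm X α x (P.anchorField β x) := by
    rw [P.form_swap, anchorField, P.apply_anchor]
  have e2 : P.form x (α x) (lieDerivOneForm X β x)
      = lieDerivOneForm X β x (P.anchorField α x) := by
    rw [anchorField, P.apply_anchor]
  have e3 : (fun y ↦ α y (P.anchorField β y)) = fun y ↦ -P.form y (α y) (β y) := by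
    funext y
    rw [anchorField, P.apply_anchor, P.form_swap]
  have e4 : (fun y ↦ β y (P.anchorField α y)) = fun y ↦ P.form y (α y) (β y) := by
    funext y
    rw [anchorField, P.apply_anchor]
  rw [lieDeriv, e1, e2, lieDerivOneForm_apply X hα (hβ.anchorField P),
    lieDerivOneForm_apply X hβ (hα.anchorField P), e3, e4, differential_neg]
  simp only [neg_apply]
  ring

theorem BivectorField.lieDeriv_swap (P : BivectorField E M) {X : VecField E M} {α β : OneForm E M}
    {x : M} (hα : DifferentiableOneFormAt α x) (hβ : DifferentiableOneFormAt β x) :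
    P.lieDeriv X α β x = -P.lieDeriv X β α x := by
  have e : (fun y ↦ P.form y (β y) (α y)) = fun y ↦ -P.form y (α y) (β y) := by
    funext y
    exact P.form_swap y _ _
  rw [P.lieDeriv_eq hα hβ, P.lieDeriv_eq hβ hα, e, differential_neg]
  simp only [neg_apply]
  ring

theorem BivectorField.tensorialAt_lieDeriv (P : BivectorField E M) (X : VecField E M)
    {β : OneForm E M} {x : M} (hβ : DifferentiableOneFormAt β x) :
    TensorialAt 𝓘(ℝ, E) (E →L[ℝ] ℝ) (fun α : OneForm E M ↦ P.lieDeriv X α β x) x where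
  smul {f α} hf hα := by
    have hfα : DifferentiableOneFormAt (f • α) x := MDifferentiableAt.smul_section hf hα
    have h1 : P.anchorField (f • α) = f • P.anchorField α := by
      funext y
      simp [anchorField]
    have h2 : (fun y ↦ P.form y ((f • α) y) (β y)) = f * fun y ↦ P.form y (α y) (β y) := by
      funext y
      simp
    rw [P.lieDeriv_eq hfα hβ, P.lieDeriv_eq hα hβ, h1,
      VectorField.mlieBracket_smul_right hf (DifferentiableOneFormAt.anchorField P hα), h2]
    have h3 : β x (P.anchorField α x) = P.form x (α x) (β x) := P.apply_anchor x _ _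
    simp only [differential, mvfderiv_mul hf (P.mdifferentiableAt_form_apply hα hβ)]
    simp [h3]
    ring
  add {α α'} hα hα' := by
    have hs : DifferentiableOneFormAt (α + α') x := mdifferentiableAt_add_section hα hα'
    have h1 : P.anchorField (α + α') = P.anchorField α + P.anchorField α' := by
      funext y
      simp [anchorField]
    have h2 : (fun y ↦ P.form y ((α + α') y) (β y))
        = (fun y ↦ P.form y (α y) (β y)) + fun y ↦ P.form y (α' y) (β y) := by
      funext y
      simp
    rw [P.lieDeriv_eq hs hβ, P.lieDeriv_eq hα hβ, P.lieDeriv_eq hα' hβ, h1,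
      VectorField.mlieBracket_add_right (DifferentiableOneFormAt.anchorField P hα)
        (DifferentiableOneFormAt.anchorField P hα'), h2]
    simp only [differential, mvfderiv_add (P.mdifferentiableAt_form_apply hα hβ)
      (P.mdifferentiableAt_form_apply hα' hβ)]
    simp
    ring

/-! ### Metric contravariant connections that are `F`-connections -/

theorem BivectorField.IsPerpOn.anchor_flatField_eq_zero {P : BivectorField E M} {g : Metric E M}
    {X : VecField E M} {U : Set M} (hX : P.IsPerpOn g X U) {x : M} (hx : x ∈ U) :
    P.anchor x (flatField g X x) = 0 :=
  P.anchor_eq_zero fun γ ↦ hX x hx _ (P.anchor_mem_leafTangent x γ)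

/-- Near a point, a vector field perpendicular to the symplectic foliation is dual to a global
one-form with values in the kernel of the anchor map. -/
theorem BivectorField.IsPerpOn.exists_oneForm [T2Space M] {P : BivectorField E M} {g : Metric E M}
    {X : VecField E M} {U : Set M} (hX : P.IsPerpOn g X U) (hXs : SmoothVectorFieldOn X U)
    (hU : IsOpen U) {x : M} (hx : x ∈ U) :
    ∃ α : OneForm E M, SmoothOneFormOn α Set.univ ∧ (∀ y, P.anchor y (α y) = 0) ∧
      ∀ᶠ y in 𝓝 x, α y = flatField g X y := by
  obtain ⟨χ, -, h2, h3, h4⟩ := (smooth_flatField g hXs).exists_extension hU hx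
  refine ⟨_, h4, fun y ↦ ?_, ?_⟩
  · by_cases hy : y ∈ U
    · rw [map_smul, hX.anchor_flatField_eq_zero hy, smul_zero]
    · rw [h2 y hy, zero_smul, map_zero]
  · filter_upwards [h3] with y hy
    simp [hy]

namespace ContravariantConnection

variable {P : BivectorField E M} {D : ContravariantConnection P}

/-- On the kernel of the anchor map, `D_β` is the Lie derivative along `P_#(β)`. -/
theorem apply_of_anchor_eq_zero (hD : D.IsTorsionFree) (hF : D.IsFConnection) {α β : OneForm E M}
    (hα : SmoothOneFormOn α Set.univ) (hαK : ∀ y, P.anchor y (α y) = 0)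
    (hβ : SmoothOneFormOn β Set.univ) {Y : VecField E M} {x : M}
    (hY : DifferentiableVecFieldAt Y x) :
    D.D β α x (Y x) = differential E (fun y ↦ α y (Y y)) x (P.anchorField β x)
      - α x (VectorField.mlieBracket 𝓘(ℝ, E) (P.anchorField β) Y x) := by
  have h1 := congrArg (fun θ : OneForm E M ↦ θ x (Y x)) (hD α β hα hβ)
  have h2 : P.anchorField α = 0 := funext hαK
  have h3 : (fun y ↦ P.form y (α y) (β y)) = fun _ ↦ 0 :=
    funext fun y ↦ P.form_of_anchor_eq_zero (hαK y) _
  simp only [hF α hα hαK β hβ, Pi.sub_apply, sub_apply,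
    P.koszulBracket_apply (hα.differentiable x) (hβ.differentiable x) hY, h2, h3,
    differential_const, VectorField.mlieBracket_zero_left] at h1
  simp at h1
  linarith

/-- `D_β` maps one-forms orthogonal to the kernel of the anchor map to such one-forms. -/
theorem coinner_flat_anchorField [T2Space M] {g : Metric E M} (hP : P.IsPoisson)
    (hD : D.IsMetricConnection g) (hF : D.IsFConnection) {α β γ : OneForm E M}
    (hα : SmoothOneFormOn α Set.univ) (hαK : ∀ y, P.anchor y (α y) = 0)
    (hβ : SmoothOneFormOn β Set.univ) (hγ : SmoothOneFormOn γ Set.univ) (x : M) :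
    coinner g x (D.D β (flatField g (P.anchorField γ)) x) (α x) = 0 := by
  have hZ := P.smooth_anchorField isOpen_univ hγ
  have h0 : ∀ y, α y (P.anchorField γ y) = 0 := fun y ↦
    P.apply_of_mem_leafTangent (hαK y) (P.anchor_mem_leafTangent y _)
  have h1 := hD.1 β _ α hβ (smooth_flatField g hZ) hα x
  have h2 : (fun y ↦ coinner g y (flatField g (P.anchorField γ) y) (α y)) = fun _ ↦ 0 := by
    funext y
    rw [coinner_comm, flatField, coinner_inner_right, h0]
  have h3 : coinner g x (flatField g (P.anchorField γ) x) (D.D β α x) = 0 := by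
    rw [coinner_comm, flatField, coinner_inner_right, apply_of_anchor_eq_zero hD.2 hF hα hαK hβ
      (hZ.differentiableAt isOpen_univ (Set.mem_univ x)), funext h0, differential_const,
      P.apply_of_mem_leafTangent (hαK x) (hP.mlieBracket_mem_leafTangent
        (hβ.differentiable x) (hγ.differentiable x))]
    simp
  rw [h2, differential_const, h3] at h1
  simpa using h1.symm

/-- The metric of an `F`-connection is bundle-like. -/
theorem isBundleLike [T2Space M] {g : Metric E M} (hD : D.IsMetricConnection g)
    (hF : D.IsFConnection) : P.IsBundleLike g := by
  intro U hU X Y hX hXp hXf hY hYp hYf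
  refine ⟨(smooth_flatField g hX).apply hY, fun x hx ↦ P.anchor_eq_zero fun γ₀ ↦ ?_⟩
  obtain ⟨γ, hγ, rfl⟩ := exists_smooth_oneForm x γ₀
  obtain ⟨a, ha, haK, hae⟩ := hXp.exists_oneForm hX hU hx
  obtain ⟨b, hb, hbK, hbe⟩ := hYp.exists_oneForm hY hU hx
  have hZU : SmoothVectorFieldOn (P.anchorField γ) U :=
    (P.smooth_anchorField isOpen_univ hγ).mono (Set.subset_univ U)
  have hZt : P.IsTangentOn (P.anchorField γ) U := fun y _ ↦ P.anchor_mem_leafTangent y _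
  have hbr : ∀ {W : VecField E M} {c : OneForm E M}, P.IsFoliatedOn W U → P.anchor x (c x) = 0 →
      c x (VectorField.mlieBracket 𝓘(ℝ, E) (P.anchorField γ) W x) = 0 := fun {W c} hW hc ↦ by
    rw [VectorField.mlieBracket_swap_apply, map_neg,
      P.apply_of_mem_leafTangent hc (hW _ hZU hZt x hx), neg_zero]
  set h : M → ℝ := fun y ↦ g.inner y (X y) (Y y) with hh
  have e1 : (fun y ↦ a y (Y y)) =ᶠ[𝓝 x] h := by
    filter_upwards [hae] with y hy
    rw [hy, flatField]
  have e2 : (fun y ↦ b y (X y)) =ᶠ[𝓝 x] h := by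
    filter_upwards [hbe] with y hy
    rw [hy, flatField, hh, g.symm]
  have e3 : (fun y ↦ coinner g y (a y) (b y)) =ᶠ[𝓝 x] h := by
    filter_upwards [hae, hbe] with y hy hy'
    rw [hy, hy', flatField, flatField, coinner_inner_right]
  have h1 := hD.1 γ a b hγ ha hb x
  rw [hae.self_of_nhds, hbe.self_of_nhds, coinner_comm g x (flatField g X x), flatField, flatField,
    coinner_inner_right, coinner_inner_right,
    apply_of_anchor_eq_zero hD.2 hF ha haK hγ (hY.differentiableAt hU hx),
    apply_of_anchor_eq_zero hD.2 hF hb hbK hγ (hX.differentiableAt hU hx),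
    hbr hYf (haK x), hbr hXf (hbK x), differential_congr e1, differential_congr e2,
    differential_congr e3] at h1
  -- With `Z = P_#γ` the equation reads `Z(h) = Z(h) + Z(h)`.
  change differential E h x (P.anchor x (γ x)) =
    differential E h x (P.anchor x (γ x)) - 0 + (differential E h x (P.anchor x (γ x)) - 0) at h1
  linarith

/-- A foliated vector field perpendicular to the symplectic foliation is a Poisson vector field. -/
theorem isPoissonVecFieldOn [T2Space M] {g : Metric E M} (hP : P.IsPoisson) (hreg : P.IsRegular)
    (hD : D.IsMetricConnection g) (hF : D.IsFConnection) {U : Set M} (hU : IsOpen U)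
    {X : VecField E M} (hX : SmoothVectorFieldOn X U) (hXp : P.IsPerpOn g X U)
    (hXf : P.IsFoliatedOn X U) : P.IsPoissonVecFieldOn X U := by
  intro φ ψ hφ hψ x hx
  have hXx := hX.differentiableAt hU hx
  have hbr : ∀ {κ γ : OneForm E M}, SmoothOneFormOn γ U → P.anchor x (κ x) = 0 →
      κ x (VectorField.mlieBracket 𝓘(ℝ, E) X (P.anchorField γ) x) = 0 := fun hγ hκ ↦
    P.apply_of_mem_leafTangent hκ
      (hXf _ (P.smooth_anchorField hU hγ) (fun y _ ↦ P.anchor_mem_leafTangent y _) x hx)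
  have hK : ∀ {κ β : OneForm E M}, SmoothOneFormOn κ Set.univ → (∀ y, P.anchor y (κ y) = 0) →
      SmoothOneFormOn β U → P.lieDeriv X κ β x = 0 := by
    intro κ β hκ hκK hβ
    have h2 : P.anchorField κ = 0 := funext hκK
    have h3 : (fun y ↦ P.form y (κ y) (β y)) = fun _ ↦ 0 :=
      funext fun y ↦ P.form_of_anchor_eq_zero (hκK y) _
    rw [P.lieDeriv_eq (hκ.differentiable x) (hβ.differentiableAt hU hx), hbr hβ (hκK x), h2, h3,
      differential_const, VectorField.mlieBracket_zero_right]
    simp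
  have hflat : ∀ {β : OneForm E M}, SmoothOneFormOn β Set.univ →
      SmoothOneFormOn (flatField g (P.anchorField β)) Set.univ := fun hβ ↦
    smooth_flatField g (P.smooth_anchorField isOpen_univ hβ)
  -- by tensoriality, only one-forms orthogonal to the kernel of the anchor map matter
  have hred : ∀ {θ β : OneForm E M}, SmoothOneFormOn θ U → SmoothOneFormOn β U →
      ∃ γ : OneForm E M, SmoothOneFormOn γ Set.univ ∧
        P.lieDeriv X θ β x = P.lieDeriv X (flatField g (P.anchorField γ)) β x := by
    intro θ β hθ hβ
    obtain ⟨κ₀, γ₀, hκ₀, hθx⟩ := P.exists_eq_add_flat_anchor g x (θ x)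
    obtain ⟨κ, hκ, hκK, rfl⟩ := P.exists_smooth_anchor_eq_zero hreg hκ₀
    obtain ⟨γ, hγ, rfl⟩ := exists_smooth_oneForm x γ₀
    have ht := P.tensorialAt_lieDeriv X (hβ.differentiableAt hU hx)
    have h1 := (hκ.differentiable x)
    have h2 := ((hflat hγ).differentiable x)
    refine ⟨γ, hγ, ?_⟩
    have e1 := ht.pointwise (σ' := κ + flatField g (P.anchorField γ))
      (hθ.differentiableAt hU hx) (mdifferentiableAt_add_section h1 h2) hθx
    refine e1.trans ((ht.add h1 h2).trans ?_)
    rw [hK hκ hκK hβ, zero_add]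
  obtain ⟨β, hβ, e1⟩ := hred hφ hψ
  have hb := hflat hβ
  obtain ⟨γ, hγ, e2⟩ := hred hψ (hb.mono (Set.subset_univ U))
  have hc := hflat hγ
  have hbx := hb.differentiable x
  have hcx := hc.differentiable x
  -- Tensoriality is available in the first slot; the swap carries the reduction to the second.
  rw [e1, P.lieDeriv_swap hbx (hψ.differentiableAt hU hx), e2, ← P.lieDeriv_swap hbx hcx]
  obtain ⟨a, ha, haK, hae⟩ := hXp.exists_oneForm hX hU hx
  have hvanish : ∀ β : OneForm E M,
      (fun y ↦ flatField g (P.anchorField β) y (X y)) =ᶠ[𝓝 x] fun _ ↦ 0 := fun β ↦ by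
    filter_upwards [hU.mem_nhds hx] with y hy
    exact (g.symm y _ _).trans (hXp y hy _ (P.anchor_mem_leafTangent y _))
  have happ : ∀ β γ : OneForm E M, SmoothOneFormOn β Set.univ → SmoothOneFormOn γ Set.univ →
      D.D β (flatField g (P.anchorField γ)) x (X x) = 0 := fun β γ hβ hγ ↦ by
    have h := coinner_flat_anchorField hP hD hF ha haK hβ hγ x
    rwa [hae.self_of_nhds, flatField, coinner_inner_right] at h
  -- Torsion-freeness evaluated on `X`: the left side is zero by `happ`, and what survives of the
  -- Koszul bracket is `L_X P` as in `lieDeriv_eq`.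
  have h1 := congrArg (fun θ : OneForm E M ↦ θ x (X x)) (hD.2 _ _ hb hc)
  simp only [Pi.sub_apply, sub_apply, happ _ _ hb hγ, happ _ _ hc hβ,
    P.koszulBracket_apply hbx hcx hXx, differential_congr (hvanish _), differential_const] at h1
  rw [VectorField.mlieBracket_swap_apply (W := X),
    VectorField.mlieBracket_swap_apply (W := X), map_neg, map_neg] at h1
  rw [P.lieDeriv_eq hbx hcx]
  simp at h1
  linarith

end ContravariantConnection

/-- A Poisson vector field of a regular Poisson tensor is foliated. -/
theorem BivectorField.IsPoissonVecFieldOn.isFoliatedOn [T2Space M] {P : BivectorField E M}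
    (hreg : P.IsRegular) {U : Set M} {X : VecField E M}
    (hXP : P.IsPoissonVecFieldOn X U) (hU : IsOpen U) : P.IsFoliatedOn X U := by
  intro Y hY hYt x hx
  refine P.mem_leafTangent fun η₀ hη₀ ↦ ?_
  obtain ⟨η, hη, hηK, rfl⟩ := P.exists_smooth_anchor_eq_zero hreg hη₀
  -- `P_#γ = Y` is arranged at `x` only; this suffices because `L_X η` is a one-form, evaluated
  -- pointwise.
  obtain ⟨γ₀, hγ₀⟩ := hYt x hx
  obtain ⟨γ, hγ, rfl⟩ := exists_smooth_oneForm x γ₀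
  have hηx := hη.differentiable x
  have hYx : P.anchorField γ x = Y x := hγ₀
  have h1 := hXP η γ (hη.mono (Set.subset_univ U)) (hγ.mono (Set.subset_univ U)) x hx
  have h2 : (fun y ↦ P.form y (η y) (γ y)) = fun _ ↦ 0 :=
    funext fun y ↦ P.form_of_anchor_eq_zero (hηK y) _
  have h3 : P.form x (lieDerivOneForm X η x) (γ x) = 0 := by
    rw [lieDeriv, h2, differential_const, P.form_of_anchor_eq_zero (hηK x)] at h1
    simpa using h1
  have h4 : lieDerivOneForm X η x (Y x) = 0 := by
    rw [← hYx, anchorField, P.apply_anchor, P.form_swap, h3, neg_zero]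
  have h5 : (fun y ↦ η y (Y y)) =ᶠ[𝓝 x] fun _ ↦ 0 := by
    filter_upwards [hU.mem_nhds hx] with y hy
    exact P.apply_of_mem_leafTangent (hηK y) (hYt y hy)
  rw [lieDerivOneForm_apply X hηx (hY.differentiableAt hU hx), differential_congr h5,
    differential_const] at h4
  simpa using h4

end RiemannPoisson

end

/-! ### The theorem. -/

theorem theorem1p1 {E : Type*} [NormedAddCommGroup E] [NormedSpace ℝ E] [FiniteDimensional ℝ E]
    {M : Type*} [TopologicalSpace M] [T2Space M] [ChartedSpace E M] [IsManifold 𝓘(ℝ, E) ∞ M]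
    (g : RiemannPoisson.Metric E M) (P : RiemannPoisson.BivectorField E M)
    (hP : P.IsPoisson) (hreg : P.IsRegular)
    (D : RiemannPoisson.ContravariantConnection P) (hD : D.IsMetricConnection g)
    (hF : D.IsFConnection) :
    P.IsBundleLike g ∧
      ∀ U : Set M, IsOpen U → ∀ X : RiemannPoisson.VecField E M,
        RiemannPoisson.SmoothVectorFieldOn X U → P.IsPerpOn g X U →
          (P.IsFoliatedOn X U ↔ P.IsPoissonVecFieldOn X U) := by
  exact ⟨RiemannPoisson.ContravariantConnection.isBundleLike hD hF, fun U hU X hX hXp ↦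
    ⟨RiemannPoisson.ContravariantConnection.isPoissonVecFieldOn hP hreg hD hF hU hX hXp,
      fun hXP ↦ hXP.isFoliatedOn hreg hU⟩⟩
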